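/- For integers $k,m\ge 0$ let $d_k(m)$ be the number of strict partitions of $m$ (partitions with pairwise distinct parts) all of whose parts are at most $k$, and put $n_k=k(k+1)/2$. Thus $$\prod_{i=1}^k(1+x^i)=\sum_{m=0}^{n_k}d_k(m)\,x^m ,$$ and the sequence is symmetric: $d_k(m)=d_k(n_k-m)$ for $0\le m\le n_k$. The following holds. (i) For $k\ge 1$, $d_k(0)=d_k(1)=1$. (ii) For $k\ge 2$, $d_k(2)=1$; moreover $d_2(3)=1$ and $d_3(4)=1$. (iii) For $k\ge 4$, $d_k(3)=d_k(4)=2$. (iv) For $k\in\{4,\dots,11\}$, further equalities $d_k(m-1)=d_k(m)$ with $m\le k(k+1)/4$ hold for the following values of $m$: $$\begin{array}{c|c|c|c|c|c|c|c|c} k&4&5&6&7&8&9&10&11\\ \hline m&5&6,7&7,8,10&8,11,13,14&16,17&19,22&26&32\end{array}$$ (v) For $k\ge 12$, $d_k(m-1)<d_k(m)$ for $5\le m\le k(k+1)/4$. Up to the equalities that follow by symmetry, including the equality $d_k\big(\tfrac{n_k-1}{2}\big)=d_k\big(\tfrac{n_k+1}{2}\big)$ in the middle when $k\equiv 1$ or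 $2 \pmod 4$, these are all equalities in the sequences $(d_k(m))_{0\le m\le n_k}$. Precisely, call $m\ge1$ a listed step for $k$ if $m=1$ and $k\ge1$, or $m=2$ and $k\ge2$, or $m=4$ and $k\ge4$, or $m$ stands in the table under $k$. Then for every $k\ge 0$: (a) $d_k(m-1)<d_k(m)$ for every $1\le m\le k(k+1)/4$ that is not a listed step for $k$; (b) for $1\le m\le n_k$, $d_k(m-1)=d_k(m)$ if and only if $m$ is a listed step for $k$, or $n_k+1-m$ is a listed step for $k$, or $2m=n_k+1$; (c) for $0\le a,b\le n_k$, $d_k(a)=d_k(b)$ if and only if $a$ and $b$ are equivalent under the equivalence relation generated by $m-1\sim m$ for the listed steps $m$ for $k$ and $j\sim n_k-j$ for $0\le j\le n_k$. -/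

import Mathlib

/-- The number `d_k(m)` of strict partitions of `m` (all parts distinct) with all parts,
equivalently the largest part, at most `k`. -/
def strictCount (k m : ℕ) : ℕ :=
  ((Nat.Partition.distincts m).filter (fun p => ∀ i ∈ p.parts, i ≤ k)).card

/-- The index `k (k + 1) / 2` of the last nonzero term of the sequence `d_k`
(the division is exact). -/
def topIndex (k : ℕ) : ℕ := k * (k + 1) / 2

/-- The table of sporadic values `m` with `d_k(m - 1) = d_k(m)`, for `4 ≤ k ≤ 11`. -/
def sporadicSteps : ℕ → Finset ℕ
  | 4 => {5}
  | 5 => {6, 7}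
  | 6 => {7, 8, 10}
  | 7 => {8, 11, 13, 14}
  | 8 => {16, 17}
  | 9 => {19, 22}
  | 10 => {26}
  | 11 => {32}
  | _ => ∅

/-- The listed steps from `m - 1` to `m` at which `d_k` does not change: the small ones
`d_k(0) = d_k(1)`, `d_k(1) = d_k(2)`, `d_k(3) = d_k(4)`, and the sporadic ones. -/
def ListedStep (k m : ℕ) : Prop :=
  (1 ≤ k ∧ m = 1) ∨ (2 ≤ k ∧ m = 2) ∨ (4 ≤ k ∧ m = 4) ∨ m ∈ sporadicSteps k

/-- Indices `a` and `b` in `0, …, k (k + 1) / 2` are directly related if `b` follows `a` by a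
listed step, or if they are mirror images of each other. -/
def BasicRel (k a b : ℕ) : Prop :=
  (b = a + 1 ∧ ListedStep k b) ∨ a + b = topIndex k

/-!
Since `d_{k+1}(m) = d_k(m) + d_k(m - (k + 1))`, strict increase up to the middle passes from row
`k` to row `k + 1` wherever `m` is still in the lower half of row `k`: both summands then grow,
the first one strictly. What remains in row `k + 1` is a window of about `k / 2` indices below the
middle (`strictCount_lt_window`), and there the recursion is of no help.

In the window the difference is a Fourier integral (`two_pow_mul_integral_cosProd`): up to a
positive factor, `d_k(m) - d_k(m - 1)` is
`∫ cos θ * cos (2 θ) * ⋯ * cos (k θ) * sin (h θ) * sin θ` over `[0, π / 2]`, where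
`h = k (k + 1) / 2 + 1 - 2 m` lies between `1` and `k`. The integrand is nonnegative up to
`π / (2 k)`, and already the interval up to `1 / k ^ 2` contributes at least a constant times
`k ^ (-6)` (`le_integral_cosProd_peak`). Beyond `π / (2 k)` the sum of the `cos (2 i θ)` is at most
`k / 4`, so that by the inequality of the means the square of the product of the cosines is at most
`(5 / 8) ^ k` (`cosProd_sq_le`). For `k ≥ 140` the peak therefore outweighs the tail.

For `12 < k < 140` the windows are checked exactly, by kernel evaluation: the value of
`∏ (1 + x ^ i)` at a large power of two has the numbers `d_k(m)` as its digits
(`packedRow_div_mod`). The rows up to `k = 12`, which contain all sporadic equalities and start the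
induction, are read off in the same way. The description of all equalities follows from strict
increase in the lower half and the symmetry of the sequence.
-/

/-! ### The counts as coefficients, their recursion and symmetry -/

theorem strictCount_eq_card_powerset (k m : ℕ) :
    strictCount k m = ((Finset.Icc 1 k).powerset.filter (fun s => ∑ i ∈ s, i = m)).card := by
  unfold strictCount
  refine Finset.card_bij (fun p _ => p.parts.toFinset) ?_ ?_ ?_
  · intro p hp
    simp only [Nat.Partition.distincts, Finset.mem_filter, Finset.mem_univ, true_and] at hp
    simp only [Finset.mem_filter, Finset.mem_powerset]
    constructor
    · intro i hi
      rw [Multiset.mem_toFinset] at hi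
      exact Finset.mem_Icc.2 ⟨p.parts_pos hi, hp.2 i hi⟩
    · rw [Finset.sum, Multiset.toFinset_val, Multiset.dedup_eq_self.2 hp.1, Multiset.map_id',
        p.parts_sum]
  · intro p hp q hq h
    simp only [Nat.Partition.distincts, Finset.mem_filter, Finset.mem_univ, true_and] at hp hq
    apply Nat.Partition.ext
    rw [← Multiset.dedup_eq_self.2 hp.1, ← Multiset.dedup_eq_self.2 hq.1,
      ← Multiset.toFinset_val, ← Multiset.toFinset_val, h]
  · intro s hs
    simp only [Finset.mem_filter, Finset.mem_powerset] at hs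
    refine ⟨⟨s.val, fun hi => (Finset.mem_Icc.1 (hs.1 hi)).1, by
      rw [← hs.2, Finset.sum, Multiset.map_id']⟩, ?_, ?_⟩
    · simp only [Nat.Partition.distincts, Finset.mem_filter, Finset.mem_univ, true_and]
      exact ⟨s.nodup, fun i hi => (Finset.mem_Icc.1 (hs.1 hi)).2⟩
    · simp

theorem coeff_prod_one_add_X_pow (k m : ℕ) :
    (∏ i ∈ Finset.Icc 1 k, (1 + Polynomial.X ^ i : Polynomial ℕ)).coeff m = strictCount k m := by
  have h (s : Finset ℕ) : ∏ i ∈ s, (Polynomial.X ^ i : Polynomial ℕ) = Polynomial.X ^ ∑ i ∈ s, i :=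
    Finset.prod_pow_eq_pow_sum s (fun i => i) _
  simp only [Finset.prod_one_add, h, Polynomial.finsetSum_coeff, Polynomial.coeff_X_pow,
    Finset.sum_boole, strictCount_eq_card_powerset, Nat.cast_id, eq_comm]

theorem strictCount_succ (k m : ℕ) :
    strictCount (k + 1) m =
      strictCount k m + if k + 1 ≤ m then strictCount k (m - (k + 1)) else 0 := by
  rw [← coeff_prod_one_add_X_pow, Finset.prod_Icc_succ_top (by omega), mul_add, mul_one,
    Polynomial.coeff_add, Polynomial.coeff_mul_X_pow', coeff_prod_one_add_X_pow,
    coeff_prod_one_add_X_pow]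

theorem strictCount_zero (m : ℕ) : strictCount 0 m = if m = 0 then 1 else 0 := by
  rw [← coeff_prod_one_add_X_pow]
  simp [Polynomial.coeff_one]

theorem strictCount_le_two_pow (k m : ℕ) : strictCount k m ≤ 2 ^ k := by
  rw [strictCount_eq_card_powerset]
  refine (Finset.card_filter_le _ _).trans ?_
  simp [Finset.card_powerset]

theorem topIndex_succ (k : ℕ) : topIndex (k + 1) = topIndex k + (k + 1) := by
  unfold topIndex
  rw [show (k + 1) * (k + 1 + 1) = k * (k + 1) + 2 * (k + 1) by ring]
  omega

theorem two_mul_topIndex (k : ℕ) : 2 * topIndex k = k * (k + 1) :=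
  Nat.mul_div_cancel' (Nat.even_mul_succ_self k).two_dvd

/-- The sequence `d_k`, extended by zero to all integer indices. -/
def strictCountInt (k : ℕ) (m : ℤ) : ℤ := if 0 ≤ m then strictCount k m.toNat else 0

@[simp] theorem strictCountInt_natCast (k m : ℕ) :
    strictCountInt k (m : ℤ) = strictCount k m := by
  simp [strictCountInt]

theorem strictCountInt_of_neg (k : ℕ) {m : ℤ} (hm : m < 0) : strictCountInt k m = 0 := by
  simp [strictCountInt, hm]

theorem strictCountInt_zero (m : ℤ) : strictCountInt 0 m = if m = 0 then 1 else 0 := by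
  rcases lt_or_ge m 0 with h | h
  · rw [strictCountInt_of_neg _ h, if_neg h.ne]
  · lift m to ℕ using h
    simp [strictCount_zero]

theorem strictCountInt_succ (k : ℕ) (m : ℤ) :
    strictCountInt (k + 1) m = strictCountInt k m + strictCountInt k (m - (k + 1)) := by
  rcases lt_or_ge m 0 with h | h
  · rw [strictCountInt_of_neg _ h, strictCountInt_of_neg _ h, strictCountInt_of_neg _ (by omega)]
    rfl
  · lift m to ℕ using h
    rw [strictCountInt_natCast, strictCountInt_natCast, strictCount_succ]
    split_ifs with h
    · rw [show (m : ℤ) - (k + 1) = ((m - (k + 1) : ℕ) : ℤ) by omega, strictCountInt_natCast]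
      push_cast; rfl
    · rw [strictCountInt_of_neg _ (by omega)]
      push_cast; rfl

theorem strictCountInt_symm (k : ℕ) (m : ℤ) :
    strictCountInt k m = strictCountInt k (topIndex k - m) := by
  induction k generalizing m with
  | zero =>
    rw [strictCountInt_zero, strictCountInt_zero]
    simp [topIndex]
  | succ k ih =>
    rw [strictCountInt_succ, strictCountInt_succ, topIndex_succ, ih m, ih (m - (k + 1)), add_comm]
    congr 2 <;> push_cast <;> ring

theorem strictCount_symm {k m : ℕ} (h : m ≤ topIndex k) :
    strictCount k m = strictCount k (topIndex k - m) := by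
  have := strictCountInt_symm k m
  rw [← Nat.cast_sub h, strictCountInt_natCast, strictCountInt_natCast] at this
  exact_mod_cast this

theorem strictCount_eq_zero {k m : ℕ} (h : topIndex k < m) : strictCount k m = 0 := by
  have := strictCountInt_symm k m
  rw [strictCountInt_of_neg _ (by omega : (topIndex k : ℤ) - m < 0), strictCountInt_natCast] at this
  exact_mod_cast this

theorem prod_one_add_X_pow_eq_sum (k : ℕ) :
    ∏ i ∈ Finset.Icc 1 k, (1 + Polynomial.X ^ i : Polynomial ℕ) =
      ∑ m ∈ Finset.range (topIndex k + 1),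
        Polynomial.C (strictCount k m) * Polynomial.X ^ m := by
  ext m
  rw [coeff_prod_one_add_X_pow]
  simp only [Polynomial.finsetSum_coeff, Polynomial.coeff_C_mul_X_pow]
  rw [Finset.sum_ite_eq]
  split_ifs with h
  · rfl
  · exact strictCount_eq_zero (by simpa using h)

theorem strictCount_succ_of_le {k m : ℕ} (h : m ≤ k) :
    strictCount (k + 1) m = strictCount k m := by
  rw [strictCount_succ, if_neg (by omega), add_zero]

/-- Parts larger than `m` do not occur in partitions of `m`. -/
theorem strictCount_eq_of_le {j k m : ℕ} (hm : m ≤ j) (hjk : j ≤ k) :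
    strictCount k m = strictCount j m := by
  induction k, hjk using Nat.le_induction with
  | base => rfl
  | succ k hk ih => rw [strictCount_succ_of_le (hm.trans hk), ih]

/-! ### Differences of neighbouring counts as integrals -/

theorem integral_cos_two_mul_int_mul (j : ℤ) :
    ∫ θ in (0 : ℝ)..Real.pi / 2, Real.cos (2 * j * θ) = if j = 0 then Real.pi / 2 else 0 := by
  split_ifs with h
  · simp [h]
  · have hj : (2 * j : ℝ) ≠ 0 := by exact_mod_cast mul_ne_zero two_ne_zero h
    rw [intervalIntegral.integral_comp_mul_left (fun x => Real.cos x) hj, integral_cos,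
      show 2 * (j : ℝ) * (Real.pi / 2) = j * Real.pi by ring, Real.sin_int_mul_pi]
    simp

/-- The trigonometric product `cos θ * cos (2 θ) * ⋯ * cos (k θ)`. -/
noncomputable def cosProd (k : ℕ) (θ : ℝ) : ℝ := ∏ i ∈ Finset.range k, Real.cos ((i + 1) * θ)

theorem continuous_cosProd (k : ℕ) : Continuous (cosProd k) := by
  unfold cosProd
  fun_prop

theorem cosProd_succ (k : ℕ) (θ : ℝ) :
    cosProd (k + 1) θ = cosProd k θ * Real.cos ((k + 1) * θ) :=
  Finset.prod_range_succ _ _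

/-- The Fourier integral for `d_k(m) - d_k(m - 1)`. On the trigonometric side the recursion
`d_{k + 1}(m) = d_k(m) + d_k(m - (k + 1))` is the product formula for `cos x * sin y`. -/
theorem two_pow_mul_integral_cosProd (k : ℕ) (m : ℤ) :
    2 ^ k * ∫ θ in (0 : ℝ)..Real.pi / 2,
      cosProd k θ * Real.sin ((topIndex k + 1 - 2 * m) * θ) * Real.sin θ =
    Real.pi / 4 * (strictCountInt k m - strictCountInt k (m - 1)) := by
  induction k generalizing m with
  | zero =>
    have h (θ : ℝ) : cosProd 0 θ * Real.sin (((topIndex 0 : ℕ) + 1 - 2 * m) * θ) * Real.sin θ =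
        1 / 2 * (Real.cos (2 * m * θ) - Real.cos (2 * (m - 1 : ℤ) * θ)) := by
      have := Real.two_mul_sin_mul_sin (((topIndex 0 : ℕ) + 1 - 2 * m) * θ) θ
      rw [show (((topIndex 0 : ℕ) + 1 - 2 * m) * θ) - θ = -(2 * m * θ) by simp [topIndex]; ring,
        show (((topIndex 0 : ℕ) + 1 - 2 * m) * θ) + θ = -(2 * (m - 1 : ℤ) * θ) by
          simp [topIndex]; ring, Real.cos_neg, Real.cos_neg] at this
      rw [← this]
      simp only [cosProd, Finset.range_zero, Finset.prod_empty]
      ring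
    simp only [h]
    rw [intervalIntegral.integral_const_mul, intervalIntegral.integral_sub
      (by apply Continuous.intervalIntegrable; fun_prop)
      (by apply Continuous.intervalIntegrable; fun_prop),
      integral_cos_two_mul_int_mul, integral_cos_two_mul_int_mul, strictCountInt_zero,
      strictCountInt_zero]
    push_cast
    split_ifs <;> ring
  | succ k ih =>
    have h (θ : ℝ) :
        cosProd (k + 1) θ * Real.sin (((topIndex (k + 1) : ℕ) + 1 - 2 * m) * θ) * Real.sin θ =
        1 / 2 * (cosProd k θ * Real.sin ((topIndex k + 1 - 2 * m) * θ) * Real.sin θ +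
          cosProd k θ * Real.sin ((topIndex k + 1 - 2 * (m - (k + 1) : ℤ)) * θ) *
            Real.sin θ) := by
      have := Real.two_mul_sin_mul_cos (((topIndex (k + 1) : ℕ) + 1 - 2 * m) * θ) ((k + 1) * θ)
      rw [show ((topIndex (k + 1) : ℕ) + 1 - 2 * (m : ℝ)) * θ - (k + 1) * θ =
          (topIndex k + 1 - 2 * m) * θ by rw [topIndex_succ]; push_cast; ring,
        show ((topIndex (k + 1) : ℕ) + 1 - 2 * (m : ℝ)) * θ + (k + 1) * θ =
          (topIndex k + 1 - 2 * (m - (k + 1) : ℤ)) * θ by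
            rw [topIndex_succ]; push_cast; ring] at this
      rw [cosProd_succ]
      linear_combination (1 / 2) * cosProd k θ * Real.sin θ * this
    have hc := continuous_cosProd k
    simp only [h]
    rw [intervalIntegral.integral_const_mul, intervalIntegral.integral_add
      (by apply Continuous.intervalIntegrable; fun_prop)
      (by apply Continuous.intervalIntegrable; fun_prop),
      show ∀ x y : ℝ, 2 ^ (k + 1) * (1 / 2 * (x + y)) = 2 ^ k * x + 2 ^ k * y by intros; ring,
      ih, ih, strictCountInt_succ, strictCountInt_succ,
      show m - (k + 1) - 1 = m - 1 - ((k : ℤ) + 1) by ring]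
    push_cast
    ring

/-! ### Positivity of the integral near the middle -/

theorem sum_range_cos_two_mul (k : ℕ) (θ : ℝ) :
    2 * Real.sin θ * ∑ i ∈ Finset.range k, Real.cos (2 * ((i + 1) * θ)) =
      Real.sin ((2 * k + 1) * θ) - Real.sin θ := by
  induction k with
  | zero => simp
  | succ k ih =>
    rw [Finset.sum_range_succ, mul_add, ih, Real.two_mul_sin_mul_cos,
      show θ - 2 * ((k + 1) * θ) = -((2 * k + 1) * θ) by ring, Real.sin_neg,
      show θ + 2 * ((k + 1) * θ) = (2 * ((k + 1 : ℕ) : ℝ) + 1) * θ by push_cast; ring]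
    ring

/-- Away from the main peak the squares of the cosines are at most `5 / 8` on average. -/
theorem sum_range_cos_two_mul_le {k : ℕ} (hk : 1 ≤ k) {θ : ℝ}
    (h1 : Real.pi / (2 * k) ≤ θ) (h2 : θ ≤ Real.pi / 2) :
    ∑ i ∈ Finset.range k, Real.cos (2 * ((i + 1) * θ)) ≤ k / 4 := by
  have hk' : (1 : ℝ) ≤ k := by exact_mod_cast hk
  have hpi := Real.pi_pos
  have hθ : 0 < θ := lt_of_lt_of_le (by positivity) h1
  have hsin : 0 < Real.sin θ := Real.sin_pos_of_pos_of_lt_pi hθ (by linarith)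
  have hsum := sum_range_cos_two_mul k θ
  have h1' : Real.pi ≤ 2 * k * θ := by
    rw [div_le_iff₀ (by positivity)] at h1; linarith
  -- Either `sin ((2 k + 1) θ)` is still in its first negative arch, or `θ` is past that arch.
  rcases le_total ((2 * k + 1) * θ) (2 * Real.pi) with h | h
  · have : Real.sin ((2 * k + 1) * θ) ≤ 0 := by
      have := Real.sin_nonneg_of_nonneg_of_le_pi (x := (2 * k + 1) * θ - Real.pi)
        (by linarith) (by linarith)
      rw [Real.sin_sub_pi] at this
      linarith
    have : 2 * Real.sin θ * ∑ i ∈ Finset.range k, Real.cos (2 * ((i + 1) * θ)) ≤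
        2 * Real.sin θ * (k / 4) := by
      rw [hsum]
      have : 0 ≤ 2 * Real.sin θ * (k / 4) := by positivity
      linarith
    exact le_of_mul_le_mul_left this (by positivity)
  · have hj := Real.mul_le_sin hθ.le h2
    have : 4 ≤ (2 * k + 1) * Real.sin θ := by
      calc (4 : ℝ) = 2 / Real.pi * (2 * Real.pi) := by field_simp; norm_num
        _ ≤ 2 / Real.pi * ((2 * k + 1) * θ) := by gcongr
        _ = (2 * k + 1) * (2 / Real.pi * θ) := by ring
        _ ≤ _ := by gcongr
    have : 2 * Real.sin θ * ∑ i ∈ Finset.range k, Real.cos (2 * ((i + 1) * θ)) ≤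
        2 * Real.sin θ * (k / 4) := by
      rw [hsum]
      have := Real.sin_le_one ((2 * k + 1) * θ)
      nlinarith
    exact le_of_mul_le_mul_left this (by positivity)

theorem cosProd_sq_le {k : ℕ} (hk : 1 ≤ k) {θ : ℝ}
    (h1 : Real.pi / (2 * k) ≤ θ) (h2 : θ ≤ Real.pi / 2) :
    cosProd k θ ^ 2 ≤ (5 / 8) ^ k := by
  have hs := sum_range_cos_two_mul_le hk h1 h2
  have hf (i : ℕ) : Real.cos ((i + 1) * θ) ^ 2 =
      5 / 8 * (4 / 5 * (1 + Real.cos (2 * ((i + 1) * θ)))) := by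
    rw [Real.cos_sq]; ring
  -- The inequality `x ≤ exp (x - 1)` serves as the inequality of the means.
  calc cosProd k θ ^ 2
      = ∏ i ∈ Finset.range k, 5 / 8 * (4 / 5 * (1 + Real.cos (2 * ((i + 1) * θ)))) := by
        rw [cosProd, ← Finset.prod_pow]
        exact Finset.prod_congr rfl fun i _ => hf i
    _ ≤ ∏ i ∈ Finset.range k,
          5 / 8 * Real.exp (4 / 5 * (1 + Real.cos (2 * ((i + 1) * θ))) - 1) := by
        refine Finset.prod_le_prod (fun i _ => by rw [← hf]; positivity) fun i _ => ?_
        have := Real.add_one_le_exp (4 / 5 * (1 + Real.cos (2 * ((i + 1) * θ))) - 1)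
        linarith
    _ = (5 / 8) ^ k * Real.exp (∑ i ∈ Finset.range k,
          (4 / 5 * (1 + Real.cos (2 * ((i + 1) * θ))) - 1)) := by
        rw [Finset.prod_mul_distrib, Real.exp_sum, Finset.prod_const, Finset.card_range]
    _ ≤ (5 / 8) ^ k * 1 := by
        gcongr
        rw [Real.exp_le_one_iff, Finset.sum_sub_distrib, ← Finset.mul_sum, Finset.sum_add_distrib]
        simp only [Finset.sum_const, Finset.card_range, nsmul_eq_mul, mul_one]
        linarith
    _ = _ := mul_one _

theorem mul_pow_twelve_mul_five_pow_le {k : ℕ} (hk : 140 ≤ k) :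
    144 * k ^ 12 * 5 ^ k ≤ 8 ^ k := by
  induction k, hk using Nat.le_induction with
  | base => norm_num
  | succ k hk ih =>
    have h1 : 140 * (k + 1) ≤ 141 * k := by omega
    have h2 : 140 ^ 12 * (k + 1) ^ 12 ≤ 141 ^ 12 * k ^ 12 := by
      rw [← mul_pow, ← mul_pow]; exact Nat.pow_le_pow_left h1 12
    have h3 : 5 * (k + 1) ^ 12 ≤ 8 * k ^ 12 := by norm_num at h2; omega
    calc 144 * (k + 1) ^ 12 * 5 ^ (k + 1) = 144 * 5 ^ k * (5 * (k + 1) ^ 12) := by ring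
      _ ≤ 144 * 5 ^ k * (8 * k ^ 12) := by gcongr
      _ = 8 * (144 * k ^ 12 * 5 ^ k) := by ring
      _ ≤ 8 * 8 ^ k := by gcongr
      _ = 8 ^ (k + 1) := by ring

theorem abs_cosProd_le {k : ℕ} (hk : 140 ≤ k) {θ : ℝ}
    (h1 : Real.pi / (2 * k) ≤ θ) (h2 : θ ≤ Real.pi / 2) :
    |cosProd k θ| ≤ 1 / (12 * k ^ 6) := by
  have hk0 : (0 : ℝ) < k := by exact_mod_cast (by omega : 0 < k)
  refine abs_le_of_sq_le_sq ?_ (by positivity)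
  refine (cosProd_sq_le (by omega) h1 h2).trans ?_
  have h : (144 * k ^ 12 * 5 ^ k : ℝ) ≤ 8 ^ k := by exact_mod_cast mul_pow_twelve_mul_five_pow_le hk
  rw [div_pow, div_pow, one_pow, div_le_div_iff₀ (by positivity) (by positivity)]
  calc (5 : ℝ) ^ k * (12 * k ^ 6) ^ 2 = 144 * k ^ 12 * 5 ^ k := by ring
    _ ≤ 1 * 8 ^ k := by linarith

/-- Comes from `cos x ≥ 1 - x ^ 2 / 2`, each argument being bounded by `k θ`. -/
theorem one_sub_le_cosProd {k : ℕ} {θ : ℝ} (h0 : 0 ≤ θ) (h : k * θ ≤ 1) :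
    1 - k ^ 3 * θ ^ 2 / 2 ≤ cosProd k θ := by
  suffices H : ∀ j ≤ k, 1 - j * (k * θ) ^ 2 / 2 ≤ cosProd j θ ∧ 0 ≤ cosProd j θ ∧
      cosProd j θ ≤ 1 by
    refine le_of_eq_of_le ?_ (H k le_rfl).1
    ring
  intro j hj
  induction j with
  | zero => simp [cosProd]
  | succ j ih =>
    obtain ⟨ih1, ih2, ih3⟩ := ih (by omega)
    have hjk : ((j : ℝ) + 1) ≤ k := by exact_mod_cast hj
    have hle : ((j : ℝ) + 1) * θ ≤ k * θ := by gcongr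
    have hnn : 0 ≤ ((j : ℝ) + 1) * θ := by positivity
    have hc := Real.one_sub_sq_div_two_le_cos (x := ((j : ℝ) + 1) * θ)
    have hsq : (((j : ℝ) + 1) * θ) ^ 2 ≤ (k * θ) ^ 2 := by gcongr
    have hsq1 : (k * θ) ^ 2 ≤ 1 := by
      have : 0 ≤ k * θ := by positivity
      nlinarith
    have hc1 := Real.cos_le_one (((j : ℝ) + 1) * θ)
    rw [cosProd_succ]
    push_cast
    refine ⟨?_, mul_nonneg ih2 (by linarith), by nlinarith⟩
    nlinarith

/-- The contribution of the main peak, up to `θ = π / (2 k)`. -/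
theorem le_integral_cosProd_peak {k h : ℕ} (hk : 140 ≤ k) (h1 : 1 ≤ h) (hhk : h ≤ k) :
    1 / (6 * (k : ℝ) ^ 6) ≤ ∫ θ in (0 : ℝ)..Real.pi / (2 * k),
      cosProd k θ * Real.sin (h * θ) * Real.sin θ := by
  have hk0 : (140 : ℝ) ≤ k := by exact_mod_cast hk
  have hh1 : (1 : ℝ) ≤ h := by exact_mod_cast h1
  have hhk' : (h : ℝ) ≤ k := by exact_mod_cast hhk
  have hpi := Real.pi_gt_three
  have hc := continuous_cosProd k
  have hcont : Continuous fun θ : ℝ => cosProd k θ * Real.sin (h * θ) * Real.sin θ := by fun_prop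
  have hb : 1 / (k : ℝ) ^ 2 ≤ Real.pi / (2 * k) := by
    rw [div_le_div_iff₀ (by positivity) (by positivity)]
    nlinarith
  rw [← intervalIntegral.integral_add_adjacent_intervals
    (hcont.intervalIntegrable 0 (1 / (k : ℝ) ^ 2)) (hcont.intervalIntegrable _ _)]
  have hfirst : 1 / (6 * (k : ℝ) ^ 6) ≤ ∫ θ in (0 : ℝ)..1 / (k : ℝ) ^ 2,
      cosProd k θ * Real.sin (h * θ) * Real.sin θ := by
    calc 1 / (6 * (k : ℝ) ^ 6) = ∫ θ in (0 : ℝ)..1 / (k : ℝ) ^ 2, 1 / 2 * θ ^ 2 := by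
          rw [intervalIntegral.integral_const_mul, integral_pow]
          norm_num
          ring
      _ ≤ _ := by
        refine intervalIntegral.integral_mono_on (by positivity)
          (by apply Continuous.intervalIntegrable; fun_prop) (hcont.intervalIntegrable _ _) ?_
        rintro θ ⟨hθ0, hθ⟩
        rcases hθ0.eq_or_lt with rfl | hθ0
        · simp
        rw [le_div_iff₀ (by positivity)] at hθ
        have hkθ : k * θ ≤ 1 / 140 := by nlinarith
        have hhθ : h * θ ≤ 1 / 140 := le_trans (by gcongr) hkθ
        have hpos : 0 < h * θ := by positivity
        have hθh : θ ≤ h * θ := by nlinarith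
        have hsin (x : ℝ) (h0 : 0 < x) (h1 : x ≤ 1 / 140) : 9 / 10 * x ≤ Real.sin x := by
          have := Real.sin_gt_sub_cube h0
          nlinarith [sq_nonneg x]
        have hs1 := hsin _ hpos hhθ
        have hs2 := hsin _ hθ0 (hθh.trans hhθ)
        have hprod : (9 / 10 : ℝ) ≤ cosProd k θ := by
          refine le_trans ?_ (one_sub_le_cosProd hθ0.le (by linarith))
          have : (k : ℝ) ^ 3 * θ ^ 2 = (θ * k ^ 2) * (k * θ) := by ring
          rw [this]
          have : (θ * (k : ℝ) ^ 2) * (k * θ) ≤ 1 * (1 / 140) := by gcongr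
          linarith
        calc 1 / 2 * θ ^ 2 ≤ 9 / 10 * (9 / 10 * θ) * (9 / 10 * θ) := by nlinarith [sq_nonneg θ]
          _ ≤ 9 / 10 * (9 / 10 * (h * θ)) * (9 / 10 * θ) := by gcongr
          _ ≤ _ := by
            have := (by norm_num : (0 : ℝ) ≤ 9 / 10).trans hprod
            gcongr
            exact mul_nonneg this ((by positivity : (0 : ℝ) ≤ 9 / 10 * (h * θ)).trans hs1)
  have hsecond : 0 ≤ ∫ θ in (1 / (k : ℝ) ^ 2)..Real.pi / (2 * k),
      cosProd k θ * Real.sin (h * θ) * Real.sin θ := by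
    refine intervalIntegral.integral_nonneg hb ?_
    rintro θ ⟨hθ0, hθ⟩
    have hθ0 : 0 ≤ θ := le_trans (by positivity) hθ0
    have hkθ : k * θ ≤ Real.pi / 2 := by
      calc (k : ℝ) * θ ≤ k * (Real.pi / (2 * k)) := by gcongr
        _ = _ := by field_simp
    have hhθ : h * θ ≤ k * θ := by gcongr
    have hθh : θ ≤ h * θ := by nlinarith
    refine mul_nonneg (mul_nonneg ?_ ?_) ?_
    · refine Finset.prod_nonneg fun i hi => Real.cos_nonneg_of_neg_pi_div_two_le_of_le ?_ ?_
      · have : 0 ≤ ((i : ℝ) + 1) * θ := by positivity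
        linarith
      · refine le_trans ?_ hkθ
        have : (i : ℝ) + 1 ≤ k := by exact_mod_cast Finset.mem_range.1 hi
        gcongr
    · exact Real.sin_nonneg_of_nonneg_of_le_pi (by positivity) (by linarith)
    · exact Real.sin_nonneg_of_nonneg_of_le_pi hθ0 (by linarith)
  linarith

theorem integral_cosProd_pos {k h : ℕ} (hk : 140 ≤ k) (h1 : 1 ≤ h) (hhk : h ≤ k) :
    0 < ∫ θ in (0 : ℝ)..Real.pi / 2, cosProd k θ * Real.sin (h * θ) * Real.sin θ := by
  have hk0 : (140 : ℝ) ≤ k := by exact_mod_cast hk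
  have hc := continuous_cosProd k
  have hcont : Continuous fun θ : ℝ => cosProd k θ * Real.sin (h * θ) * Real.sin θ := by fun_prop
  rw [← intervalIntegral.integral_add_adjacent_intervals
    (hcont.intervalIntegrable 0 (Real.pi / (2 * k))) (hcont.intervalIntegrable _ _)]
  have hpi := Real.pi_pos
  have hle : Real.pi / (2 * k) ≤ Real.pi / 2 := by gcongr; linarith
  have htail := intervalIntegral.norm_integral_le_of_norm_le_const
    (a := Real.pi / (2 * k)) (b := Real.pi / 2) (C := 1 / (12 * (k : ℝ) ^ 6))
    (f := fun θ : ℝ => cosProd k θ * Real.sin (h * θ) * Real.sin θ) (by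
      intro θ hθ
      rw [Set.uIoc_of_le hle] at hθ
      rw [Real.norm_eq_abs, abs_mul, abs_mul]
      calc |cosProd k θ| * |Real.sin (h * θ)| * |Real.sin θ|
          ≤ 1 / (12 * (k : ℝ) ^ 6) * 1 * 1 := by
            gcongr
            · exact abs_cosProd_le hk hθ.1.le hθ.2
            · exact Real.abs_sin_le_one _
            · exact Real.abs_sin_le_one _
        _ = _ := by ring)
  have hlen : |Real.pi / 2 - Real.pi / (2 * k)| < 2 := by
    rw [abs_of_nonneg (by linarith)]
    have : 0 < Real.pi / (2 * k) := by positivity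
    linarith [Real.pi_lt_four]
  have hC : 0 < 1 / (12 * (k : ℝ) ^ 6) := by positivity
  have hpeak := le_integral_cosProd_peak hk h1 hhk
  have hC2 : 1 / (6 * (k : ℝ) ^ 6) = 1 / (12 * (k : ℝ) ^ 6) * 2 := by field_simp; norm_num
  have := neg_abs_le (∫ θ in Real.pi / (2 * k)..Real.pi / 2,
    cosProd k θ * Real.sin (h * θ) * Real.sin θ)
  rw [Real.norm_eq_abs] at htail
  nlinarith

theorem strictCount_lt_window_of_ge {k m : ℕ} (hk : 139 ≤ k)
    (hm : k * (k + 1) < 4 * m) (hm' : 4 * m ≤ (k + 1) * (k + 2)) :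
    strictCount (k + 1) (m - 1) < strictCount (k + 1) m := by
  have ht := two_mul_topIndex k
  have ht' := two_mul_topIndex (k + 1)
  have hs := topIndex_succ k
  obtain ⟨h, hh⟩ : ∃ h, topIndex (k + 1) + 1 = h + 2 * m :=
    ⟨topIndex (k + 1) + 1 - 2 * m, by
      rw [add_assoc, show 1 + 1 = 2 from rfl] at ht'; omega⟩
  have hpos := integral_cosProd_pos (k := k + 1) (h := h) (by omega)
    (by rw [add_assoc, show 1 + 1 = 2 from rfl] at ht'; omega) (by omega)
  have key := two_pow_mul_integral_cosProd (k + 1) m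
  have hcast : ((topIndex (k + 1) : ℕ) : ℝ) + 1 - 2 * ((m : ℤ) : ℝ) = h := by
    have : ((topIndex (k + 1) : ℕ) : ℝ) + 1 = h + 2 * m := by exact_mod_cast hh
    push_cast
    linarith
  rw [hcast, show (m : ℤ) - 1 = ((m - 1 : ℕ) : ℤ) by omega, strictCountInt_natCast,
    strictCountInt_natCast] at key
  have : 0 < Real.pi / 4 * (((strictCount (k + 1) m : ℤ) : ℝ) -
      ((strictCount (k + 1) (m - 1) : ℤ) : ℝ)) := by
    rw [← key]; positivity
  have := pos_of_mul_pos_right this (by positivity)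
  push_cast at this
  exact_mod_cast sub_pos.1 this

/-! ### Exact values from one long integer -/

theorem eval_div_pow_mod_eq_coeff {B : ℕ} (p : Polynomial ℕ) (hp : ∀ i, p.coeff i < B) (m : ℕ) :
    p.eval B / B ^ m % B = p.coeff m := by
  have hB : 0 < B := (Nat.zero_le _).trans_lt (hp 0)
  have key : ∀ q : Polynomial ℕ, q.eval B = q.coeff 0 + B * q.divX.eval B := by
    intro q
    conv_lhs => rw [← Polynomial.divX_mul_X_add q]
    simp only [Polynomial.eval_add, Polynomial.eval_mul, Polynomial.eval_X, Polynomial.eval_C]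
    ring
  induction m generalizing p with
  | zero => rw [pow_zero, Nat.div_one, key, Nat.add_mul_mod_self_left, Nat.mod_eq_of_lt (hp 0)]
  | succ m ih =>
    rw [pow_succ', ← Nat.div_div_eq_div_mul, key, Nat.add_mul_div_left _ _ hB,
      Nat.div_eq_of_lt (hp 0), zero_add,
      ih p.divX (fun i => by rw [Polynomial.coeff_divX]; exact hp _), Polynomial.coeff_divX]

/-- The value of `∏ (1 + x ^ i)`, over `1 ≤ i ≤ k`, at `x = 2 ^ 140`: its digits in base `2 ^ 140`
are the numbers `d_k(m)`, as long as `k < 140`. -/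
def packedRow : ℕ → ℕ
  | 0 => 1
  | k + 1 => packedRow k * (1 + (2 ^ 140) ^ (k + 1))

theorem packedRow_eq_eval (k : ℕ) :
    packedRow k =
      (∏ i ∈ Finset.Icc 1 k, (1 + Polynomial.X ^ i : Polynomial ℕ)).eval (2 ^ 140) := by
  induction k with
  | zero => simp [packedRow]
  | succ k ih =>
    rw [Finset.prod_Icc_succ_top (by omega), Polynomial.eval_mul, ← ih, packedRow]
    simp only [Polynomial.eval_add, Polynomial.eval_one, Polynomial.eval_pow, Polynomial.eval_X]

theorem packedRow_div_mod {k : ℕ} (hk : k < 140) (m : ℕ) :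
    packedRow k / (2 ^ 140) ^ m % 2 ^ 140 = strictCount k m := by
  rw [packedRow_eq_eval, eval_div_pow_mod_eq_coeff, coeff_prod_one_add_X_pow]
  intro i
  rw [coeff_prod_one_add_X_pow]
  exact (strictCount_le_two_pow k i).trans_lt (Nat.pow_lt_pow_right (by norm_num) hk)

/-- Whether the lowest `n + 1` digits of `x` in base `2 ^ 140` increase strictly. -/
def digitsIncrease : ℕ → ℕ → Bool
  | 0, _ => true
  | n + 1, x =>
    (x % 2 ^ 140).blt (x / 2 ^ 140 % 2 ^ 140) && digitsIncrease n (x / 2 ^ 140)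

theorem lt_of_digitsIncrease {n x : ℕ} (h : digitsIncrease n x = true) {j : ℕ} (hj : j < n) :
    x / (2 ^ 140) ^ j % 2 ^ 140 < x / (2 ^ 140) ^ (j + 1) % 2 ^ 140 := by
  induction n generalizing x j with
  | zero => omega
  | succ n ih =>
    rw [digitsIncrease, Bool.and_eq_true] at h
    cases j with
    | zero => simpa [Nat.blt] using h.1
    | succ j =>
      have := ih h.2 (j := j) (by omega)
      rwa [Nat.div_div_eq_div_mul, ← pow_succ', Nat.div_div_eq_div_mul, ← pow_succ'] at this

/-- Whether, for each of the `n` rows that follow row `k`, the sequence increases strictly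
through the middle window, which for row `k + 1` reaches from `k (k + 1) / 4` to
`(k + 1) (k + 2) / 4`. The number `x` is the packed row `k`. Only one division per row is by a
large power; `digitsIncrease` then shifts by a single digit at a time. -/
def windowsIncrease : ℕ → ℕ → ℕ → Bool
  | 0, _, _ => true
  | n + 1, k, x =>
    digitsIncrease ((k + 1) * (k + 2) / 4 - k * (k + 1) / 4)
      (x * (1 + (2 ^ 140) ^ (k + 1)) / (2 ^ 140) ^ (k * (k + 1) / 4)) &&
    windowsIncrease n (k + 1) (x * (1 + (2 ^ 140) ^ (k + 1)))

theorem digitsIncrease_of_windowsIncrease {n k : ℕ}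
    (h : windowsIncrease n k (packedRow k) = true) {j : ℕ} (hkj : k ≤ j) (hj : j < k + n) :
    digitsIncrease ((j + 1) * (j + 2) / 4 - j * (j + 1) / 4)
      (packedRow (j + 1) / (2 ^ 140) ^ (j * (j + 1) / 4)) = true := by
  induction n generalizing k with
  | zero => omega
  | succ n ih =>
    rw [windowsIncrease, Bool.and_eq_true] at h
    rcases hkj.eq_or_lt with rfl | hlt
    · exact h.1
    · exact ih h.2 hlt (by omega)

/-- The exact check of the middle windows of the rows `13, …, 139`. -/
theorem windowsIncrease_rows : windowsIncrease 127 12 (packedRow 12) = true := by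
  decide +kernel

theorem strictCount_lt_window_of_lt {k m : ℕ} (hk : 12 ≤ k) (hk' : k < 139)
    (hm : k * (k + 1) < 4 * m) (hm' : 4 * m ≤ (k + 1) * (k + 2)) :
    strictCount (k + 1) (m - 1) < strictCount (k + 1) m := by
  obtain ⟨j, hj⟩ : ∃ j, m = k * (k + 1) / 4 + j + 1 := ⟨m - 1 - k * (k + 1) / 4, by omega⟩
  have := lt_of_digitsIncrease
    (digitsIncrease_of_windowsIncrease windowsIncrease_rows hk hk') (j := j) (by omega)
  rw [Nat.div_div_eq_div_mul, ← pow_add, Nat.div_div_eq_div_mul, ← pow_add,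
    packedRow_div_mod (by omega), packedRow_div_mod (by omega)] at this
  rw [hj]
  exact this

instance decidableListedStep (k m : ℕ) : Decidable (ListedStep k m) :=
  inferInstanceAs (Decidable (_ ∨ _))

/-- The digit of the packed row `k` at position `m`. -/
def packedDigit (k m : ℕ) : ℕ := packedRow k / (2 ^ 140) ^ m % 2 ^ 140

theorem packedDigit_eq {k : ℕ} (hk : k < 140) (m : ℕ) : packedDigit k m = strictCount k m :=
  packedRow_div_mod hk m

/-- The bound `40` is enough: for `k ≤ 12` the middle is at most `12 * 13 / 4 = 39`. -/
theorem packedDigit_eq_of_listedStep : ∀ k < 13, ∀ m < 40, ListedStep k m →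
    packedDigit k (m - 1) = packedDigit k m := by
  decide +kernel

theorem packedDigit_lt_of_not_listedStep : ∀ k < 13, ∀ m < 40, 1 ≤ m ∧ 4 * m ≤ k * (k + 1) →
    ¬ ListedStep k m → packedDigit k (m - 1) < packedDigit k m := by
  decide +kernel

theorem packedDigit_values :
    (∀ m < 5, packedDigit 4 m = if m < 3 then 1 else 2) ∧
    packedDigit 1 1 = 1 ∧ packedDigit 2 2 = 1 ∧ packedDigit 2 3 = 1 ∧ packedDigit 3 4 = 1 := by
  decide +kernel

theorem sporadicSteps_eq_empty {k : ℕ} (hk : k < 4 ∨ 12 ≤ k) : sporadicSteps k = ∅ := by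
  unfold sporadicSteps
  split <;> first | rfl | omega

theorem four_mul_le_of_mem_sporadicSteps : ∀ {k m : ℕ}, m ∈ sporadicSteps k →
    k < 12 ∧ m < 40 ∧ 5 ≤ m ∧ 4 * m ≤ k * (k + 1) := by
  have h : ∀ k < 12, ∀ m ∈ sporadicSteps k, m < 40 ∧ 5 ≤ m ∧ 4 * m ≤ k * (k + 1) := by
    decide +kernel
  intro k m hm
  by_cases hk : k < 12
  · exact ⟨hk, h k hk m hm⟩
  · rw [sporadicSteps_eq_empty (by omega)] at hm
    simp at hm

/-! ### Strict increase for `k ≥ 12` -/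

theorem strictCount_lt_window {k m : ℕ} (hk : 12 ≤ k)
    (hm : k * (k + 1) < 4 * m) (hm' : 4 * m ≤ (k + 1) * (k + 2)) :
    strictCount (k + 1) (m - 1) < strictCount (k + 1) m := by
  rcases lt_or_ge k 139 with h | h
  · exact strictCount_lt_window_of_lt hk h hm hm'
  · exact strictCount_lt_window_of_ge h hm hm'

theorem strictCount_of_lt_five {k m : ℕ} (hk : 4 ≤ k) (hm : m < 5) :
    strictCount k m = if m < 3 then 1 else 2 := by
  rw [strictCount_eq_of_le (j := 4) (by omega) hk, ← packedDigit_eq (by norm_num)]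
  exact packedDigit_values.1 m hm

theorem strictCount_lt_of_twelve_le {k m : ℕ} (hk : 12 ≤ k) (hm : 5 ≤ m)
    (hkm : 4 * m ≤ k * (k + 1)) : strictCount k (m - 1) < strictCount k m := by
  induction k, hk using Nat.le_induction generalizing m with
  | base =>
    have hl : ¬ ListedStep 12 m := by
      rintro (h | h | h | h)
      · omega
      · omega
      · omega
      · simp [sporadicSteps] at h
    have := packedDigit_lt_of_not_listedStep 12 (by norm_num) m (by omega) ⟨by omega, hkm⟩ hl
    rwa [packedDigit_eq (by norm_num), packedDigit_eq (by norm_num)] at this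
  | succ k hk ih =>
    rcases lt_or_ge (k * (k + 1)) (4 * m) with h | h
    · exact strictCount_lt_window hk h hkm
    · -- Below the middle of row `k` both summands of the recursion are under control.
      have h1 := ih hm h
      rw [strictCount_succ, strictCount_succ k m]
      rcases lt_or_ge m (k + 1 + 1) with h2 | h2
      · rw [if_neg (by omega)]
        omega
      · rw [if_pos (by omega), if_pos (by omega)]
        have h3 : strictCount k (m - 1 - (k + 1)) ≤ strictCount k (m - (k + 1)) := by
          rw [show m - 1 - (k + 1) = m - (k + 1) - 1 by omega]
          rcases lt_or_ge (m - (k + 1)) 5 with h4 | h4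
          · rw [strictCount_of_lt_five (by omega) (by omega),
              strictCount_of_lt_five (by omega) h4]
            split_ifs <;> omega
          · exact (ih h4 (by omega)).le
        omega

/-! ### The listed steps are all equalities -/

theorem strictCount_eq_of_listedStep {k m : ℕ} (h : ListedStep k m) :
    strictCount k (m - 1) = strictCount k m := by
  have hsmall (hk : k < 13) (hm : m < 40) : strictCount k (m - 1) = strictCount k m := by
    rw [← packedDigit_eq (by omega), ← packedDigit_eq (by omega)]
    exact packedDigit_eq_of_listedStep k hk m hm h
  rcases lt_or_ge k 13 with hk | hk
  · refine hsmall hk ?_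
    rcases h with h | h | h | h
    · omega
    · omega
    · omega
    · exact (four_mul_le_of_mem_sporadicSteps h).2.1
  · have hm : m = 1 ∨ m = 2 ∨ m = 4 := by
      rcases h with h | h | h | h
      · omega
      · omega
      · omega
      · have := four_mul_le_of_mem_sporadicSteps h
        omega
    rw [strictCount_of_lt_five (by omega) (by omega), strictCount_of_lt_five (by omega) (by omega)]
    rcases hm with rfl | rfl | rfl <;> rfl

theorem strictCount_lt_of_not_listedStep {k m : ℕ} (hm : 1 ≤ m) (hkm : 4 * m ≤ k * (k + 1))
    (h : ¬ ListedStep k m) : strictCount k (m - 1) < strictCount k m := by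
  rcases lt_or_ge k 13 with hk | hk
  · have : k * (k + 1) ≤ 12 * 13 := Nat.mul_le_mul (by omega) (by omega)
    rw [← packedDigit_eq (by omega), ← packedDigit_eq (by omega)]
    exact packedDigit_lt_of_not_listedStep k hk m (by omega) ⟨hm, hkm⟩ h
  · rcases lt_or_ge m 5 with hm5 | hm5
    · have hm3 : m = 3 := by
        simp only [ListedStep, not_or] at h
        omega
      subst hm3
      rw [strictCount_of_lt_five (by omega) (by omega),
        strictCount_of_lt_five (by omega) (by omega)]
      decide
    · exact strictCount_lt_of_twelve_le (by omega) hm5 hkm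

theorem strictCount_pred_eq_iff_of_le {k m : ℕ} (hm : 1 ≤ m) (hkm : 4 * m ≤ k * (k + 1)) :
    strictCount k (m - 1) = strictCount k m ↔ ListedStep k m :=
  ⟨fun h => by_contra fun hl => (strictCount_lt_of_not_listedStep hm hkm hl).ne h,
    strictCount_eq_of_listedStep⟩

theorem strictCount_middle {k m : ℕ} (h : 2 * m = topIndex k + 1) :
    strictCount k (m - 1) = strictCount k m := by
  rw [strictCount_symm (show m ≤ topIndex k by omega), show topIndex k - m = m - 1 by omega]

/-- The symmetry carries the step from `m - 1` to `m` to the step into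
`topIndex k + 1 - m`, reversed. -/
theorem strictCount_pred_mirror {k m : ℕ} (hm : 1 ≤ m) (hkm : m ≤ topIndex k) :
    strictCount k (topIndex k + 1 - m - 1) = strictCount k m ∧
      strictCount k (topIndex k + 1 - m) = strictCount k (m - 1) := by
  constructor
  · rw [strictCount_symm hkm]
    congr 1
    omega
  · rw [strictCount_symm (show m - 1 ≤ topIndex k by omega)]
    congr 1
    omega

theorem strictCount_pred_eq_iff {k m : ℕ} (hm : 1 ≤ m) (hkm : m ≤ topIndex k) :
    strictCount k (m - 1) = strictCount k m ↔
      ListedStep k m ∨ ListedStep k (topIndex k + 1 - m) ∨ 2 * m = topIndex k + 1 := by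
  have ht := two_mul_topIndex k
  obtain ⟨hr1, hr2⟩ := strictCount_pred_mirror hm hkm
  constructor
  · intro h
    rcases lt_trichotomy (2 * m) (topIndex k + 1) with hlt | heq | hgt
    · exact Or.inl ((strictCount_pred_eq_iff_of_le hm (by omega)).1 h)
    · exact Or.inr (Or.inr heq)
    · refine Or.inr (Or.inl ((strictCount_pred_eq_iff_of_le (by omega) (by omega)).1 ?_))
      rw [hr1, hr2, h]
  · rintro (h | h | h)
    · exact strictCount_eq_of_listedStep h
    · have := strictCount_eq_of_listedStep h
      rw [hr1, hr2] at this
      exact this.symm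
    · exact strictCount_middle h

theorem strictCount_pred_le {k m : ℕ} (hm : 1 ≤ m) (hkm : 2 * m ≤ topIndex k) :
    strictCount k (m - 1) ≤ strictCount k m := by
  have ht := two_mul_topIndex k
  by_cases h : ListedStep k m
  · exact (strictCount_eq_of_listedStep h).le
  · exact (strictCount_lt_of_not_listedStep hm (by omega) h).le

theorem strictCount_mono {k a b : ℕ} (hab : a ≤ b) (hb : 2 * b ≤ topIndex k) :
    strictCount k a ≤ strictCount k b := by
  induction b, hab using Nat.le_induction with
  | base => rfl
  | succ b hab ih =>
    have h := strictCount_pred_le (by omega) hb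
    rw [Nat.add_sub_cancel] at h
    exact (ih (by omega)).trans h

/-! ### Equalities between arbitrary terms -/

theorem eqvGen_of_strictCount_eq_of_le {k a b : ℕ} (hab : a ≤ b) (hb : 2 * b ≤ topIndex k)
    (h : strictCount k a = strictCount k b) : Relation.EqvGen (BasicRel k) a b := by
  have ht := two_mul_topIndex k
  induction b, hab using Nat.le_induction with
  | base => exact .refl _
  | succ b hab ih =>
    have h1 := strictCount_mono hab (show 2 * b ≤ topIndex k by omega)
    have h2 := strictCount_mono (show b ≤ b + 1 by omega) hb
    have h3 : strictCount k b = strictCount k (b + 1) := by omega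
    refine .trans _ _ _ (ih (by omega) (by omega)) (.rel _ _ (Or.inl ⟨rfl, ?_⟩))
    refine (strictCount_pred_eq_iff_of_le (by omega) (by omega)).1 ?_
    rw [Nat.add_sub_cancel, h3]

theorem eqvGen_of_strictCount_eq {k a b : ℕ} (ha : a ≤ topIndex k) (hb : b ≤ topIndex k)
    (h : strictCount k a = strictCount k b) : Relation.EqvGen (BasicRel k) a b := by
  -- Both indices are first reflected into the lower half.
  have lower (c : ℕ) (hc : c ≤ topIndex k) : ∃ d, 2 * d ≤ topIndex k ∧
      strictCount k d = strictCount k c ∧ Relation.EqvGen (BasicRel k) c d := by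
    rcases le_total (2 * c) (topIndex k) with h | h
    · exact ⟨c, h, rfl, .refl _⟩
    · exact ⟨topIndex k - c, by omega, (strictCount_symm hc).symm,
        .rel _ _ (Or.inr (by omega))⟩
  obtain ⟨a', ha', hae, har⟩ := lower a ha
  obtain ⟨b', hb', hbe, hbr⟩ := lower b hb
  have h' : strictCount k a' = strictCount k b' := by rw [hae, hbe, h]
  refine .trans _ _ _ har (.trans _ _ _ ?_ (.symm _ _ hbr))
  rcases le_total a' b' with hab | hab
  · exact eqvGen_of_strictCount_eq_of_le hab hb' h'
  · exact .symm _ _ (eqvGen_of_strictCount_eq_of_le hab ha' h'.symm)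

theorem strictCount_eq_of_eqvGen {k a b : ℕ} (h : Relation.EqvGen (BasicRel k) a b) :
    strictCount k a = strictCount k b := by
  induction h with
  | rel a b h =>
    rcases h with ⟨rfl, h⟩ | h
    · have := strictCount_eq_of_listedStep h
      rwa [Nat.add_sub_cancel] at this
    · rw [strictCount_symm (show a ≤ topIndex k by omega), show topIndex k - a = b by omega]
  | refl a => rfl
  | symm a b _ ih => exact ih.symm
  | trans a b c _ _ ih1 ih2 => exact ih1.trans ih2

theorem mainTheorem5 :
    -- the counts are the coefficients of the product, and form a symmetric sequence
    (∀ k : ℕ, ∏ i ∈ Finset.Icc 1 k, (1 + Polynomial.X ^ i : Polynomial ℕ) =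
      ∑ m ∈ Finset.range (topIndex k + 1),
        Polynomial.C (strictCount k m) * Polynomial.X ^ m) ∧
    (∀ k m : ℕ, m ≤ topIndex k → strictCount k m = strictCount k (topIndex k - m)) ∧
    -- (i)
    (∀ k : ℕ, 1 ≤ k → strictCount k 0 = 1 ∧ strictCount k 1 = 1) ∧
    -- (ii)
    ((∀ k : ℕ, 2 ≤ k → strictCount k 2 = 1) ∧ strictCount 2 3 = 1 ∧ strictCount 3 4 = 1) ∧
    -- (iii)
    (∀ k : ℕ, 4 ≤ k → strictCount k 3 = 2 ∧ strictCount k 4 = 2) ∧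
    -- (iv)
    (∀ k : ℕ, ∀ m ∈ sporadicSteps k,
      4 * m ≤ k * (k + 1) ∧ strictCount k (m - 1) = strictCount k m) ∧
    -- (v)
    (∀ k m : ℕ, 12 ≤ k → 5 ≤ m → 4 * m ≤ k * (k + 1) →
      strictCount k (m - 1) < strictCount k m) ∧
    -- the equality in the middle of a sequence of even length
    (∀ k : ℕ, k % 4 = 1 ∨ k % 4 = 2 →
      strictCount k ((topIndex k - 1) / 2) = strictCount k ((topIndex k + 1) / 2)) ∧
    -- strict increase up to the middle at every step that is not listed
    (∀ k m : ℕ, 1 ≤ m → 4 * m ≤ k * (k + 1) → ¬ ListedStep k m →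
      strictCount k (m - 1) < strictCount k m) ∧
    -- all equalities between neighbours
    (∀ k m : ℕ, 1 ≤ m → m ≤ topIndex k →
      (strictCount k (m - 1) = strictCount k m ↔
        ListedStep k m ∨ ListedStep k (topIndex k + 1 - m) ∨ 2 * m = topIndex k + 1)) ∧
    -- all equalities between arbitrary terms follow from the listed ones and the symmetry
    (∀ k a b : ℕ, a ≤ topIndex k → b ≤ topIndex k →
      (strictCount k a = strictCount k b ↔ Relation.EqvGen (BasicRel k) a b)) := by
  refine ⟨prod_one_add_X_pow_eq_sum, fun k m hm => strictCount_symm hm, ?_, ⟨?_, ?_, ?_⟩, ?_, ?_,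
    fun k m hk hm hkm => strictCount_lt_of_twelve_le hk hm hkm, ?_,
    fun k m hm hkm h => strictCount_lt_of_not_listedStep hm hkm h,
    fun k m hm hkm => strictCount_pred_eq_iff hm hkm,
    fun k a b ha hb => ⟨eqvGen_of_strictCount_eq ha hb, strictCount_eq_of_eqvGen⟩⟩
  · intro k hk
    have h1 : strictCount k 1 = 1 := by
      rw [strictCount_eq_of_le le_rfl hk, ← packedDigit_eq (by norm_num)]
      exact packedDigit_values.2.1
    exact ⟨(strictCount_eq_of_listedStep (Or.inl ⟨hk, rfl⟩)).trans h1, h1⟩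
  · intro k hk
    rw [strictCount_eq_of_le le_rfl hk, ← packedDigit_eq (by norm_num)]
    exact packedDigit_values.2.2.1
  · rw [← packedDigit_eq (by norm_num)]
    exact packedDigit_values.2.2.2.1
  · rw [← packedDigit_eq (by norm_num)]
    exact packedDigit_values.2.2.2.2
  · intro k hk
    exact ⟨strictCount_of_lt_five hk (by norm_num), strictCount_of_lt_five hk (by norm_num)⟩
  · intro k m hm
    exact ⟨(four_mul_le_of_mem_sporadicSteps hm).2.2.2,
      strictCount_eq_of_listedStep (Or.inr (Or.inr (Or.inr hm)))⟩
  · intro k hk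
    -- In these residue classes the top index is odd, so the two indices are neighbours.
    have hodd : topIndex k % 2 = 1 := by
      have ht := two_mul_topIndex k
      rcases hk with hk | hk
      · obtain ⟨q, rfl⟩ : ∃ q, k = 4 * q + 1 := ⟨k / 4, by omega⟩
        have : topIndex (4 * q + 1) = 2 * (4 * q ^ 2 + 3 * q) + 1 := by linarith
        omega
      · obtain ⟨q, rfl⟩ : ∃ q, k = 4 * q + 2 := ⟨k / 4, by omega⟩
        have : topIndex (4 * q + 2) = 2 * (4 * q ^ 2 + 5 * q + 1) + 1 := by linarith
        omega
    have := strictCount_middle (k := k) (m := (topIndex k + 1) / 2) (by omega)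
    rwa [show (topIndex k + 1) / 2 - 1 = (topIndex k - 1) / 2 by omega] at this
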